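/- Let $n\in\{1,2\}$ and let $\Omega\subset\mathbb{R}^n$ be a bounded open set with smooth boundary. Then there is a constant $C=C(\Omega)>0$, and for every $\kappa>0$ there is a constant $C_o=C_o(\kappa,\Omega)>0$, such that the following holds. Let $w_0\in H^2(\Omega)$ satisfy $\inf_{x\in\Omega}w_0(x)=\kappa$ (essential infimum, i.e. the infimum of the continuous representative), let $0<r<\frac{\kappa}{2C}$, let $w\in B_r(w_0)=\{\psi\in H^2(\Omega):\ \|\psi-w_0\|_{H^2(\Omega)}\le r\}$, and let $v\in H^{-1}(\Omega)$, the dual space of $H^1_0(\Omega)$ with the dual norm. Then the boundary value problem $$\nabla\cdot\left(w^3\nabla\tilde u\right)=v\ \text{ in }\Omega,\qquad \tilde u=0\ \text{ on }\partial\Omega,$$ has a unique weak solution $\tilde u\in H^1_0(\Omega)$, that is, a unique $\tilde u\in H^1_0(\Omega)$ such that for all $\varphi\in H^1_0(\Omega)$ the function $w^3\,\nabla\tilde u\cdot\nabla\varphi$ is integrable on $\Omega$ and $$-\int_\Omega w^3\,\nabla\tilde u\cdot\nabla\varphi\,dx=\langle v,\varphi\rangle,$$ and it satisfies $$\|\tilde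 u\|_{H^1(\Omega)}\le C_o\,\|v\|_{H^{-1}(\Omega)}.$$ -/

import Mathlib

open MeasureTheory Set Filter Topology
open scoped ContDiff

noncomputable section

namespace Elliptic

variable {n : ℕ}

/-- `ℝⁿ` with its Euclidean norm and Lebesgue measure. -/
abbrev E (n : ℕ) : Type := EuclideanSpace ℝ (Fin n)

/-- The boundary of the open set `Ω` is smooth: near each boundary point, `Ω` is the positivity set
of a smooth function whose differential at that point does not vanish. (By the implicit function
theorem this is the same as `Ω` lying locally on one side of the graph of a smooth function.) -/
def HasSmoothBoundary (Ω : Set (E n)) : Prop :=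
  ∀ p ∈ frontier Ω, ∃ (U : Set (E n)) (ρ : E n → ℝ),
    IsOpen U ∧ p ∈ U ∧ ContDiffOn ℝ ∞ ρ U ∧ fderiv ℝ ρ p ≠ 0 ∧ Ω ∩ U = {x ∈ U | 0 < ρ x}

/-- The partial derivative `∂ᵢ φ`. -/
def pderiv (i : Fin n) (φ : E n → ℝ) (x : E n) : ℝ :=
  fderiv ℝ φ x (EuclideanSpace.single i 1)

/-- `φ ∈ C_c^∞(Ω)` (extended by zero to `ℝⁿ`). -/
structure IsTestFunction (Ω : Set (E n)) (φ : E n → ℝ) : Prop where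
  contDiff : ContDiff ℝ ∞ φ
  hasCompactSupport : HasCompactSupport φ
  tsupport_subset : tsupport φ ⊆ Ω

/-- The real space `L²(Ω)`. -/
abbrev L2 (Ω : Set (E n)) : Type := Lp ℝ 2 (volume.restrict Ω)

/-- `g = ∂ᵢ f` weakly in `Ω`. -/
def HasWeakPartial (Ω : Set (E n)) (i : Fin n) (f g : L2 Ω) : Prop :=
  ∀ φ : E n → ℝ, IsTestFunction Ω φ →
    ∫ x in Ω, f x * pderiv i φ x = -∫ x in Ω, g x * φ x

namespace IsTestFunction

variable {Ω : Set (E n)} {φ ψ : E n → ℝ}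

theorem zero : IsTestFunction Ω (0 : E n → ℝ) where
  contDiff := contDiff_const
  hasCompactSupport := HasCompactSupport.zero
  tsupport_subset := by simp [tsupport]

theorem add (hφ : IsTestFunction Ω φ) (hψ : IsTestFunction Ω ψ) : IsTestFunction Ω (φ + ψ) where
  contDiff := hφ.contDiff.add hψ.contDiff
  hasCompactSupport := hφ.hasCompactSupport.add hψ.hasCompactSupport
  tsupport_subset :=
    (tsupport_add φ ψ).trans (union_subset hφ.tsupport_subset hψ.tsupport_subset)

theorem smul (c : ℝ) (hφ : IsTestFunction Ω φ) : IsTestFunction Ω (c • φ) where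
  contDiff := hφ.contDiff.const_smul c
  hasCompactSupport := hφ.hasCompactSupport.smul_left (f := fun _ => c)
  tsupport_subset := (tsupport_smul_subset_right (fun _ => c) φ).trans hφ.tsupport_subset

theorem integrable_mul (hφ : IsTestFunction Ω φ) (f : L2 Ω) :
    Integrable (fun x => f x * φ x) (volume.restrict Ω) :=
  MemLp.integrable_mul (p := 2) (q := 2) (Lp.memLp f)
    (hφ.contDiff.continuous.memLp_of_hasCompactSupport hφ.hasCompactSupport)

theorem integrable_mul_pderiv (hφ : IsTestFunction Ω φ) (i : Fin n) (f : L2 Ω) :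
    Integrable (fun x => f x * pderiv i φ x) (volume.restrict Ω) := by
  have hc : Continuous (pderiv i φ) :=
    (hφ.contDiff.continuous_fderiv (by simp)).clm_apply continuous_const
  have hs : HasCompactSupport (pderiv i φ) := hφ.hasCompactSupport.fderiv_apply ℝ _
  exact MemLp.integrable_mul (p := 2) (q := 2) (Lp.memLp f) (hc.memLp_of_hasCompactSupport hs)

end IsTestFunction

namespace HasWeakPartial

variable {Ω : Set (E n)} {i : Fin n} {f g f' g' : L2 Ω}

theorem zero : HasWeakPartial Ω i 0 0 := by
  intro φ _
  have h (ψ : E n → ℝ) : ∫ x in Ω, (0 : L2 Ω) x * ψ x = 0 := by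
    rw [integral_congr_ae (g := fun _ => 0), integral_zero]
    filter_upwards [Lp.coeFn_zero ℝ 2 (volume.restrict Ω)] with x hx
    rw [hx, Pi.zero_apply, zero_mul]
  rw [h, h, neg_zero]

theorem add (h : HasWeakPartial Ω i f g) (h' : HasWeakPartial Ω i f' g') :
    HasWeakPartial Ω i (f + f') (g + g') := by
  intro φ hφ
  have h1 : ∫ x in Ω, (f + f') x * pderiv i φ x
      = ∫ x in Ω, (f x * pderiv i φ x + f' x * pderiv i φ x) :=
    integral_congr_ae (by
      filter_upwards [Lp.coeFn_add f f'] with x hx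
      rw [hx, Pi.add_apply, add_mul])
  have h2 : ∫ x in Ω, (g + g') x * φ x = ∫ x in Ω, (g x * φ x + g' x * φ x) :=
    integral_congr_ae (by
      filter_upwards [Lp.coeFn_add g g'] with x hx
      rw [hx, Pi.add_apply, add_mul])
  rw [h1, h2, integral_add (hφ.integrable_mul_pderiv i f) (hφ.integrable_mul_pderiv i f'),
    integral_add (hφ.integrable_mul g) (hφ.integrable_mul g'), h φ hφ, h' φ hφ]
  ring

theorem smul (c : ℝ) (h : HasWeakPartial Ω i f g) : HasWeakPartial Ω i (c • f) (c • g) := by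
  intro φ hφ
  have h1 : ∫ x in Ω, (c • f) x * pderiv i φ x = ∫ x in Ω, c * (f x * pderiv i φ x) :=
    integral_congr_ae (by
      filter_upwards [Lp.coeFn_smul c f] with x hx
      rw [hx, Pi.smul_apply, smul_eq_mul, mul_assoc])
  have h2 : ∫ x in Ω, (c • g) x * φ x = ∫ x in Ω, c * (g x * φ x) :=
    integral_congr_ae (by
      filter_upwards [Lp.coeFn_smul c g] with x hx
      rw [hx, Pi.smul_apply, smul_eq_mul, mul_assoc])
  rw [h1, h2, integral_const_mul, integral_const_mul, h φ hφ]
  ring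

end HasWeakPartial

/-- The Sobolev space `H¹(Ω)`. A function `u` is stored together with its weak gradient, which it
determines; the norm is `‖u‖² = ‖u‖²_{L²} + ∑ᵢ ‖∂ᵢu‖²_{L²}`. -/
def H1 (Ω : Set (E n)) : Submodule ℝ (WithLp 2 (L2 Ω × PiLp 2 fun _ : Fin n => L2 Ω)) where
  carrier := {z | ∀ i, HasWeakPartial Ω i z.fst (z.snd i)}
  zero_mem' _ := HasWeakPartial.zero
  add_mem' h h' i := (h i).add (h' i)
  smul_mem' c _ h i := (h i).smul c

/-- The `L²` class of `u ∈ H¹(Ω)`. -/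
def H1.fn {Ω : Set (E n)} (u : H1 Ω) : L2 Ω := u.1.fst

/-- The weak partial derivative `∂ᵢu` of `u ∈ H¹(Ω)`. -/
def H1.grad {Ω : Set (E n)} (u : H1 Ω) (i : Fin n) : L2 Ω := u.1.snd i

/-- The Sobolev space `H²(Ω)`: those `u ∈ H¹(Ω)`, stored together with their weak Hessian, whose
weak derivatives `∂ⱼ∂ᵢu` lie in `L²(Ω)`; the norm is
`‖u‖² = ‖u‖²_{H¹} + ∑ᵢⱼ ‖∂ⱼ∂ᵢu‖²_{L²}`. -/
def H2 (Ω : Set (E n)) :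
    Submodule ℝ (WithLp 2 (H1 Ω × PiLp 2 fun _ : Fin n × Fin n => L2 Ω)) where
  carrier := {z | ∀ i j, HasWeakPartial Ω j (H1.grad z.fst i) (z.snd (i, j))}
  zero_mem' _ _ := HasWeakPartial.zero
  add_mem' h h' i j := (h i j).add (h' i j)
  smul_mem' c _ h i j := (h i j).smul c

/-- The `L²` class of `w ∈ H²(Ω)`. -/
def H2.fn {Ω : Set (E n)} (w : H2 Ω) : L2 Ω := H1.fn w.1.fst

/-- The elements of `H¹(Ω)` that are given by functions in `C_c^∞(Ω)`. -/
def testSubmodule (Ω : Set (E n)) : Submodule ℝ (H1 Ω) where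
  carrier := {u | ∃ φ, IsTestFunction Ω φ ∧ H1.fn u =ᵐ[volume.restrict Ω] φ}
  zero_mem' := ⟨0, IsTestFunction.zero, Lp.coeFn_zero ℝ 2 (volume.restrict Ω)⟩
  add_mem' := by
    rintro u v ⟨φ, hφ, hu⟩ ⟨ψ, hψ, hv⟩
    exact ⟨φ + ψ, hφ.add hψ, (Lp.coeFn_add (H1.fn u) (H1.fn v)).trans (hu.add hv)⟩
  smul_mem' := by
    rintro c u ⟨φ, hφ, hu⟩
    exact ⟨c • φ, hφ.smul c, (Lp.coeFn_smul c (H1.fn u)).trans (hu.const_smul c)⟩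

/-- `H¹₀(Ω)`: the closure of `C_c^∞(Ω)` in `H¹(Ω)`, with the norm of `H¹(Ω)`. -/
def H10 (Ω : Set (E n)) : Submodule ℝ (H1 Ω) := (testSubmodule Ω).topologicalClosure

/-- `H⁻¹(Ω)`: the continuous dual of `H¹₀(Ω)`, with the operator norm. -/
abbrev Hneg1 (Ω : Set (E n)) : Type := StrongDual ℝ (H10 Ω)

/-- `u ∈ H¹₀(Ω)` is a weak solution of `∇·(w³∇u) = v` in `Ω`, `u = 0` on `∂Ω`: for every
`φ ∈ H¹₀(Ω)`, the function `w³ ∇u·∇φ` is integrable and `-∫_Ω w³ ∇u·∇φ dx = ⟨v, φ⟩`. -/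
def IsWeakSolution {Ω : Set (E n)} (w : H2 Ω) (v : Hneg1 Ω) (u : H10 Ω) : Prop :=
  ∀ φ : H10 Ω,
    Integrable (fun x => H2.fn w x ^ 3 * ∑ i, H1.grad u.1 i x * H1.grad φ.1 i x) (volume.restrict Ω) ∧
    -∫ x in Ω, H2.fn w x ^ 3 * ∑ i, H1.grad u.1 i x * H1.grad φ.1 i x = v φ

end Elliptic

end

noncomputable section

namespace Elliptic

open scoped NNReal ENNReal Convolution

variable {n : ℕ}

/-! The bound `r < κ / (2 * C)` makes sense once `C` is the constant of the embedding `H²(Ω) ⊂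
L^∞(Ω)`: then `w ≥ κ - C r ≥ κ/2` a.e., so `w³ ≥ (κ/2)³`. With the Poincaré inequality this makes `∫
w³ ∇u·∇φ` coercive on `H¹₀(Ω)`, and Lax–Milgram gives existence, uniqueness and the estimate. The
upper bound on `w³` gives only integrability and continuity of the form, so it does not enter `C₀`.

The embedding (`exists_sup_bound`) is proved without extension operators. Smoothness of the boundary
gives, near each `p ∈ closure Ω`, fixed vectors `a`, `b` such that every parallelogram `x + s a + t
b`, `0 ≤ s, t ≤ 1`, stays in `Ω` (`exists_spreading_cone`). A one-dimensional trace inequality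
applied along `a` and then along `b` bounds `|f x|` by the integral over that parallelogram of
`|f|`, `|∂ₐf|`, `|∂_b f|`, `|∂_b∂ₐf|` (`abs_moll_le`, for mollifications), and changing variables
turns this into integrals over `Ω`. No derivatives beyond second order occur because there are at
most two directions. Compactness of the closure makes the constant uniform. -/

/-! ### Parallelograms contained in `Ω` -/

/-- The image of the uniform measure on the unit square under `(s, t) ↦ s a + t b` has density at
most `K`. -/
def Spreads (a b : E n) (K : ℝ≥0) : Prop :=
  (((volume.restrict (Ioc (0 : ℝ) 1)).prod (volume.restrict (Ioc (0 : ℝ) 1))).map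
    fun q : ℝ × ℝ => q.1 • a + q.2 • b) ≤ K • (volume : Measure (E n))

/-- A linear isomorphism carries Haar measure to Haar measure, which is unique up to a factor. -/
theorem exists_map_volume_eq_smul {V : Type*} [NormedAddCommGroup V] [NormedSpace ℝ V]
    [FiniteDimensional ℝ V] [MeasurableSpace V] [BorelSpace V] (μ : Measure V) [μ.IsAddHaarMeasure]
    (L : V →ₗ[ℝ] E n) (hL : Function.Injective L) (hdim : Module.finrank ℝ V = n) :
    ∃ K : ℝ≥0, μ.map L = K • (volume : Measure (E n)) := by
  let e : V ≃L[ℝ] E n :=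
    (L.linearEquivOfInjective hL (by simpa using hdim)).toContinuousLinearEquiv
  have : (μ.map e).IsAddHaarMeasure := e.isAddHaarMeasure_map μ
  exact ⟨_, Measure.isAddLeftInvariant_eq_smul (μ.map e) volume⟩

theorem exists_spreads_of_injective (hn : n = 2) {a b : E n}
    (h : ∀ s t : ℝ, s • a + t • b = 0 → s = 0 ∧ t = 0) : ∃ K, Spreads a b K := by
  let L : ℝ × ℝ →ₗ[ℝ] E n :=
    (LinearMap.toSpanSingleton ℝ (E n) a).coprod (LinearMap.toSpanSingleton ℝ (E n) b)
  have hLapp : ∀ q : ℝ × ℝ, L q = q.1 • a + q.2 • b := fun q => by simp [L]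
  have hL : Function.Injective L := by
    rw [injective_iff_map_eq_zero]
    intro q hq
    rw [hLapp] at hq
    exact Prod.ext (h _ _ hq).1 (h _ _ hq).2
  obtain ⟨K, hK⟩ := exists_map_volume_eq_smul (volume : Measure (ℝ × ℝ)) L hL (by simp [hn])
  refine ⟨K, ?_⟩
  rw [Spreads, ← hK, show (fun q : ℝ × ℝ => q.1 • a + q.2 • b) = L from (funext hLapp).symm,
    Measure.prod_restrict]
  exact Measure.map_mono Measure.restrict_le_self (by
    exact (LinearMap.continuous_of_finiteDimensional L).measurable)

/-- In dimension one the variable `t` is idle and integrates out with mass one. -/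
theorem exists_spreads_zero_right (hn : n = 1) {a : E n} (ha : a ≠ 0) : ∃ K, Spreads a 0 K := by
  let L : ℝ →ₗ[ℝ] E n := LinearMap.toSpanSingleton ℝ (E n) a
  have hL : Function.Injective L := by
    intro s t hst
    simpa [L, ha] using hst
  have hLm : Measurable L := (LinearMap.continuous_of_finiteDimensional L).measurable
  obtain ⟨K, hK⟩ := exists_map_volume_eq_smul (volume : Measure ℝ) L hL (by simp [hn])
  refine ⟨K, ?_⟩
  rw [Spreads, ← hK, show (fun q : ℝ × ℝ => q.1 • a + q.2 • (0 : E n)) = L ∘ Prod.fst from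
    funext fun q => by simp [L], ← Measure.map_map hLm measurable_fst, Measure.map_fst_prod]
  simp only [Measure.restrict_apply_univ, Real.volume_Ioc, sub_zero, ENNReal.ofReal_one, one_smul]
  exact Measure.map_mono Measure.restrict_le_self hLm

theorem eventually_apply_pos {ℓ : E n →L[ℝ] ℝ} {a : E n} (h : 0 < ℓ a) :
    ∀ᶠ ℓ' in 𝓝 ℓ, 0 ≤ ℓ' a := by
  have hc : Continuous fun ℓ' : E n →L[ℝ] ℝ => ℓ' a := by fun_prop
  exact (hc.continuousAt.eventually_const_lt h).mono fun _ => le_of_lt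

/-- Positivity of `ℓ` on a vector persists for nearby functionals. In the plane, adding a kernel
vector `k` to `a` leaves the value `ℓ a > 0` unchanged and gives a second, independent direction; on
the line, `b = 0` serves. The scale `δ` is left free, to be shrunk later at the cost of `K`. -/
theorem exists_spreading_directions (hn : n = 1 ∨ n = 2) {ℓ : E n →L[ℝ] ℝ} (hℓ : ℓ ≠ 0) :
    ∃ a b : E n, (∀ᶠ ℓ' in 𝓝 ℓ, 0 ≤ ℓ' a ∧ 0 ≤ ℓ' b) ∧
      ∀ δ : ℝ, 0 < δ → ∃ K, Spreads (δ • a) (δ • b) K := by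
  obtain ⟨a, ha⟩ : ∃ a, 0 < ℓ a := by
    obtain ⟨x, hx⟩ := DFunLike.ne_iff.1 hℓ
    rcases lt_or_gt_of_ne hx with h | h
    · exact ⟨-x, by simpa using h⟩
    · exact ⟨x, by simpa using h⟩
  have ha0 : a ≠ 0 := fun h => by simp [h] at ha
  rcases hn with hn | hn
  · refine ⟨a, 0, (eventually_apply_pos ha).mono fun _ h => ⟨h, by simp⟩, fun δ hδ => ?_⟩
    rw [smul_zero]
    exact exists_spreads_zero_right hn (smul_ne_zero hδ.ne' ha0)
  · obtain ⟨k, hk, hk0⟩ : ∃ k ∈ LinearMap.ker (ℓ : E n →ₗ[ℝ] ℝ), k ≠ 0 := by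
      refine Submodule.exists_mem_ne_zero_of_ne_bot (LinearMap.ker_ne_bot_of_finrank_lt ?_)
      simp [hn]
    have hk' : ℓ k = 0 := by simpa using hk
    refine ⟨a, a + k, (eventually_apply_pos ha).and (eventually_apply_pos (by simpa [hk'] using ha)),
      fun δ hδ => exists_spreads_of_injective hn fun s t hst => ?_⟩
    have h1 : s + t = 0 := by
      have := congrArg ℓ hst
      simp only [map_add, map_smul, hk', smul_eq_mul, map_zero, add_zero] at this
      have h2 : (s + t) * (δ * ℓ a) = 0 := by linarith
      exact (mul_eq_zero.1 h2).resolve_right (by positivity)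
    obtain rfl : s = -t := by linarith
    have h3 : (t * δ) • k = 0 := by
      rw [← hst]; module
    have : t = 0 := by simpa [hk0, hδ.ne'] using h3
    simp [this]

/-- Near a boundary point `Ω` is `{ρ > 0}`, and `ρ` does not decrease along directions on which all
nearby differentials of `ρ` are nonnegative. Short moves in such directions therefore cannot leave
`Ω`. -/
theorem exists_spreading_cone (hn : n = 1 ∨ n = 2) {Ω : Set (E n)} (hopen : IsOpen Ω)
    (hsmooth : HasSmoothBoundary Ω) {p : E n} (hp : p ∈ closure Ω) :
    ∃ V ∈ 𝓝 p, ∃ a b : E n, ∃ K, Spreads a b K ∧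
      ∀ x ∈ V ∩ Ω, ∀ s ∈ Icc (0 : ℝ) 1, ∀ t ∈ Icc (0 : ℝ) 1, x + (s • a + t • b) ∈ Ω := by
  suffices H : ∃ (ℓ : E n →L[ℝ] ℝ), ℓ ≠ 0 ∧ ∀ a b : E n,
      (∀ᶠ ℓ' in 𝓝 ℓ, 0 ≤ ℓ' a ∧ 0 ≤ ℓ' b) → ∃ ε > 0, ∀ x ∈ Metric.ball p ε ∩ Ω, ∀ s t : ℝ,
        0 ≤ s → 0 ≤ t → ‖s • a + t • b‖ < ε → x + (s • a + t • b) ∈ Ω by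
    obtain ⟨ℓ, hℓ, H⟩ := H
    obtain ⟨a, b, hab, hK⟩ := exists_spreading_directions hn hℓ
    obtain ⟨ε, hε, hx⟩ := H a b hab
    -- This scale makes every vector of the scaled parallelogram shorter than `ε`.
    set δ := ε / (‖a‖ + ‖b‖ + 1) with hδ_def
    have hδ : 0 < δ := by positivity
    obtain ⟨K, hK⟩ := hK δ hδ
    refine ⟨Metric.ball p ε, Metric.ball_mem_nhds p hε, δ • a, δ • b, K, hK,
      fun x hxV s hs t ht => ?_⟩
    rw [smul_smul, smul_smul]
    refine hx x hxV _ _ (mul_nonneg hs.1 hδ.le) (mul_nonneg ht.1 hδ.le) ?_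
    calc ‖(s * δ) • a + (t * δ) • b‖ ≤ ‖(s * δ) • a‖ + ‖(t * δ) • b‖ := norm_add_le _ _
      _ = s * (δ * ‖a‖) + t * (δ * ‖b‖) := by
        rw [norm_smul, norm_smul, Real.norm_of_nonneg (mul_nonneg hs.1 hδ.le),
          Real.norm_of_nonneg (mul_nonneg ht.1 hδ.le)]
        ring
      _ ≤ 1 * (δ * ‖a‖) + 1 * (δ * ‖b‖) := by
        gcongr
        exacts [hs.2, ht.2]
      _ < δ * (‖a‖ + ‖b‖ + 1) := by linarith
      _ = ε := by rw [hδ_def]; field_simp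
  by_cases hpΩ : p ∈ Ω
  · have : Nontrivial (E n) := by
      have : Nonempty (Fin n) := ⟨⟨0, by omega⟩⟩
      infer_instance
    obtain ⟨x, hx⟩ := exists_ne (0 : E n)
    -- At an interior point any nonzero functional will do, since all short moves stay in `Ω`.
    refine ⟨innerSL ℝ x, fun h => hx ?_, fun a b _ => ?_⟩
    · simpa using DFunLike.congr_fun h x
    · obtain ⟨ε, hε, hball⟩ := Metric.isOpen_iff.1 hopen p hpΩ
      refine ⟨ε / 2, by positivity, fun y hy s t _ _ hst => hball ?_⟩
      have h1 := mem_ball_iff_norm.1 hy.1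
      rw [mem_ball_iff_norm, add_sub_right_comm]
      exact (norm_add_le _ _).trans_lt (by linarith)
  · obtain ⟨U, ρ, hU, hpU, hρ, hρ0, hΩ⟩ :=
      hsmooth p ⟨hp, by rwa [hopen.interior_eq]⟩
    refine ⟨fderiv ℝ ρ p, hρ0, fun a b hab => ?_⟩
    have hcont : ContinuousAt (fderiv ℝ ρ) p :=
      (hρ.continuousOn_fderiv_of_isOpen hU (by simp)).continuousAt (hU.mem_nhds hpU)
    obtain ⟨ε, hε, hball⟩ := Metric.eventually_nhds_iff_ball.1
      ((hcont.eventually hab).and (hU.eventually_mem hpU))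
    refine ⟨ε / 2, by positivity, fun y hy s t hs ht hst => ?_⟩
    set d := s • a + t • b with hd
    have hseg : ∀ τ ∈ Icc (0 : ℝ) 1, y + τ • d ∈ Metric.ball p ε := by
      intro τ hτ
      have h1 := mem_ball_iff_norm.1 hy.1
      have h2 : ‖τ • d‖ ≤ ‖d‖ := by
        rw [norm_smul, Real.norm_of_nonneg hτ.1]
        exact mul_le_of_le_one_left (norm_nonneg _) hτ.2
      rw [mem_ball_iff_norm, add_sub_right_comm]
      exact (norm_add_le _ _).trans_lt (by linarith)
    have hder : ∀ τ ∈ Icc (0 : ℝ) 1,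
        HasDerivAt (fun τ : ℝ => ρ (y + τ • d)) (fderiv ℝ ρ (y + τ • d) d) τ := by
      intro τ hτ
      have h1 : HasFDerivAt ρ (fderiv ℝ ρ (y + τ • d)) (y + τ • d) :=
        ((hρ.contDiffAt (hU.mem_nhds (hball _ (hseg τ hτ)).2)).differentiableAt
          (by simp)).hasFDerivAt
      have h2 : HasDerivAt (fun τ : ℝ => y + τ • d) d τ := by
        simpa using ((hasDerivAt_id τ).smul_const d).const_add y
      exact h1.comp_hasDerivAt τ h2
    have hmono : MonotoneOn (fun τ : ℝ => ρ (y + τ • d)) (Icc 0 1) := by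
      refine monotoneOn_of_deriv_nonneg (convex_Icc 0 1)
        (fun τ hτ => (hder τ hτ).continuousAt.continuousWithinAt)
        (fun τ hτ => (hder τ (interior_subset hτ)).differentiableAt.differentiableWithinAt)
        (fun τ hτ => ?_)
      have hτ' := interior_subset hτ
      rw [(hder τ hτ').deriv, hd, map_add, map_smul, map_smul]
      obtain ⟨h1, h2⟩ := (hball _ (hseg τ hτ')).1
      exact add_nonneg (mul_nonneg hs h1) (mul_nonneg ht h2)
    have hyU : y ∈ U := by simpa using (hball _ (hseg 0 (by simp))).2
    have hy0 : 0 < ρ y := (hΩ ▸ (⟨hy.2, hyU⟩ : y ∈ Ω ∩ U) : y ∈ {x ∈ U | 0 < ρ x}).2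
    have h01 : ρ y ≤ ρ (y + d) := by
      simpa using hmono (by simp : (0 : ℝ) ∈ Icc (0 : ℝ) 1) (by simp : (1 : ℝ) ∈ Icc (0 : ℝ) 1)
        zero_le_one
    have hmem : y + d ∈ {x ∈ U | 0 < ρ x} :=
      ⟨by simpa using (hball _ (hseg 1 (by simp))).2, hy0.trans_le h01⟩
    rw [← hΩ] at hmem
    exact hmem.1

/-! ### Directional weak derivatives and mollification -/

/-- `g = ∂ₐ f` weakly in `Ω`, for a direction `a`. -/
def HasWeakDeriv (Ω : Set (E n)) (a : E n) (f g : L2 Ω) : Prop :=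
  ∀ φ : E n → ℝ, IsTestFunction Ω φ →
    ∫ x in Ω, f x * fderiv ℝ φ x a = -∫ x in Ω, g x * φ x

theorem HasWeakPartial.sum {Ω : Set (E n)} {i : Fin n} {ι : Type*} (s : Finset ι)
    {f g : ι → L2 Ω} (h : ∀ j, HasWeakPartial Ω i (f j) (g j)) :
    HasWeakPartial Ω i (∑ j ∈ s, f j) (∑ j ∈ s, g j) := by
  classical
  induction s using Finset.induction_on with
  | empty => simpa using HasWeakPartial.zero
  | insert j s hj ih =>
    rw [Finset.sum_insert hj, Finset.sum_insert hj]
    exact (h j).add ih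

theorem integral_mul_eq_inner {Ω : Set (E n)} {φ : E n → ℝ} (hφ : MemLp φ 2 (volume.restrict Ω))
    (f : L2 Ω) : ∫ x in Ω, f x * φ x = inner ℝ hφ.toLp f := by
  rw [L2.inner_def]
  refine integral_congr_ae ?_
  filter_upwards [hφ.coeFn_toLp] with x hx
  simp [hx]

theorem integral_L2_sum_smul_mul {Ω : Set (E n)} {ι : Type*} (s : Finset ι) (c : ι → ℝ)
    (g : ι → L2 Ω) {φ : E n → ℝ} (hφ : MemLp φ 2 (volume.restrict Ω)) :
    ∫ x in Ω, (∑ i ∈ s, c i • g i : L2 Ω) x * φ x = ∑ i ∈ s, c i * ∫ x in Ω, g i x * φ x := by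
  simp only [integral_mul_eq_inner hφ, inner_sum, inner_smul_right]

theorem fderiv_apply_eq_sum_pderiv (φ : E n → ℝ) (x a : E n) :
    fderiv ℝ φ x a = ∑ i, a i * pderiv i φ x := by
  conv_lhs => rw [← (EuclideanSpace.basisFun (Fin n) ℝ).sum_repr a]
  simp [pderiv]

theorem IsTestFunction.memLp {Ω : Set (E n)} {φ : E n → ℝ} (hφ : IsTestFunction Ω φ)
    (μ : Measure (E n)) [IsFiniteMeasureOnCompacts μ] : MemLp φ 2 μ :=
  hφ.contDiff.continuous.memLp_of_hasCompactSupport hφ.hasCompactSupport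

theorem HasWeakDeriv.of_partial {Ω : Set (E n)} {f : L2 Ω} {g : Fin n → L2 Ω}
    (h : ∀ i, HasWeakPartial Ω i f (g i)) (a : E n) : HasWeakDeriv Ω a f (∑ i, a i • g i) := by
  intro φ hφ
  rw [integral_L2_sum_smul_mul _ _ _ (hφ.memLp _)]
  simp only [fderiv_apply_eq_sum_pderiv, Finset.mul_sum]
  rw [integral_finsetSum, ← Finset.sum_neg_distrib]
  · refine Finset.sum_congr rfl fun i _ => ?_
    simp only [mul_left_comm _ (a i), integral_const_mul]
    rw [h i φ hφ]
    ring
  · intro i _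
    simp only [mul_left_comm _ (a i)]
    exact (hφ.integrable_mul_pderiv i f).const_mul _

/-- The mollification of `g ∈ L²(Ω)`, extended by zero, by a normalized bump function. -/
def moll {Ω : Set (E n)} (η : ContDiffBump (0 : E n)) (g : L2 Ω) : E n → ℝ :=
  η.normed volume ⋆[ContinuousLinearMap.lsmul ℝ ℝ, volume] Ω.indicator g

section Mollifier

variable {Ω : Set (E n)}

theorem isFiniteMeasure_restrict_of_isBounded (hbdd : Bornology.IsBounded Ω) :
    IsFiniteMeasure (volume.restrict Ω : Measure (E n)) :=
  isFiniteMeasure_restrict.2 hbdd.measure_lt_top.ne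

theorem integrable_indicator_L2 (hopen : IsOpen Ω) (hbdd : Bornology.IsBounded Ω)
    (g : L2 Ω) : Integrable (Ω.indicator g) volume := by
  have := isFiniteMeasure_restrict_of_isBounded hbdd
  exact (integrable_indicator_iff hopen.measurableSet).2
    ((Lp.memLp g).integrable (by norm_num))

theorem moll_apply (hopen : IsOpen Ω) (η : ContDiffBump (0 : E n)) (g : L2 Ω) (x : E n) :
    moll η g x = ∫ y in Ω, g y * η.normed volume (x - y) := by
  rw [moll, convolution_eq_swap, ← integral_indicator hopen.measurableSet]
  refine integral_congr_ae (Eventually.of_forall fun y => ?_)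
  by_cases hy : y ∈ Ω <;> simp [hy, mul_comm]

theorem isTestFunction_normed_sub (η : ContDiffBump (0 : E n)) {x : E n}
    (hx : Metric.closedBall x η.rOut ⊆ Ω) :
    IsTestFunction Ω fun y => η.normed volume (x - y) := by
  have hs : tsupport (fun y => η.normed volume (x - y)) ⊆ Metric.closedBall x η.rOut := by
    refine closure_minimal (fun y hy => ?_) Metric.isClosed_closedBall
    have : x - y ∈ Function.support (η.normed volume) := hy
    rw [η.support_normed_eq, mem_ball_zero_iff] at this
    rw [Metric.mem_closedBall, dist_comm, dist_eq_norm]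
    exact this.le
  refine ⟨(η.contDiff_normed (μ := volume)).comp (contDiff_const.sub contDiff_id), ?_, hs.trans hx⟩
  exact (isCompact_closedBall x _).of_isClosed_subset (isClosed_tsupport _) hs

theorem exists_hasFDerivAt_moll (hopen : IsOpen Ω) (hbdd : Bornology.IsBounded Ω)
    (η : ContDiffBump (0 : E n)) (g : L2 Ω) (x a : E n) :
    ∃ D : E n →L[ℝ] ℝ, HasFDerivAt (moll η g) D x ∧
      D a = ∫ y in Ω, g y * fderiv ℝ (η.normed volume) (x - y) a := by
  have hg := (integrable_indicator_L2 hopen hbdd g).locallyIntegrable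
  have hη : ContDiff ℝ 1 (η.normed volume) := η.contDiff_normed (n := 1)
  have hηc := η.hasCompactSupport_normed (μ := volume)
  rw [moll, ← convolution_flip]
  refine ⟨_, hηc.hasFDerivAt_convolution_right _ hg hη x, ?_⟩
  rw [convolution_precompR_apply _ hg (hηc.fderiv ℝ) (hη.continuous_fderiv one_ne_zero),
    convolution_def, ← integral_indicator hopen.measurableSet]
  refine integral_congr_ae (Eventually.of_forall fun y => ?_)
  by_cases hy : y ∈ Ω <;> simp [hy, mul_comm]

/-- When the ball around the point lies in `Ω`, the reflected bump `y ↦ η(x + s a - y)` is a test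
function. The sign from the reflection cancels the sign in the definition of the weak derivative. -/
theorem hasDerivAt_moll (hopen : IsOpen Ω) (hbdd : Bornology.IsBounded Ω)
    (η : ContDiffBump (0 : E n)) {a : E n} {f g : L2 Ω} (hfg : HasWeakDeriv Ω a f g) {x : E n}
    {s : ℝ} (hx : Metric.closedBall (x + s • a) η.rOut ⊆ Ω) :
    HasDerivAt (fun s : ℝ => moll η f (x + s • a)) (moll η g (x + s • a)) s := by
  obtain ⟨D, hD, hDa⟩ := exists_hasFDerivAt_moll hopen hbdd η f (x + s • a) a
  have h1 : HasDerivAt (fun s : ℝ => x + s • a) a s := by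
    simpa using ((hasDerivAt_id s).smul_const a).const_add x
  suffices h2 : moll η g (x + s • a) = D a from h2 ▸ hD.comp_hasDerivAt s h1
  rw [hDa, moll_apply hopen, ← neg_eq_iff_eq_neg.2 (hfg _ (isTestFunction_normed_sub η hx)),
    ← integral_neg]
  refine integral_congr_ae (Eventually.of_forall fun y => ?_)
  have h3 : HasFDerivAt (fun y => η.normed volume (x + s • a - y))
      ((fderiv ℝ (η.normed volume) (x + s • a - y)).comp (-ContinuousLinearMap.id ℝ (E n))) y :=
    (((η.contDiff_normed (n := 1)).differentiable one_ne_zero _).hasFDerivAt).comp y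
      ((hasFDerivAt_id y).const_sub _)
  simp [h3.fderiv]

theorem continuous_moll (hopen : IsOpen Ω) (hbdd : Bornology.IsBounded Ω)
    (η : ContDiffBump (0 : E n)) (g : L2 Ω) : Continuous (moll η g) :=
  continuous_iff_continuousAt.2 fun x =>
    let ⟨_, hD, _⟩ := exists_hasFDerivAt_moll hopen hbdd η g x 0
    hD.continuousAt

/-- Young's inequality in `L¹`: the bump is nonnegative with integral one. -/
theorem lintegral_enorm_moll_le (hopen : IsOpen Ω) (hbdd : Bornology.IsBounded Ω)
    (η : ContDiffBump (0 : E n)) (g : L2 Ω) :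
    ∫⁻ x, ‖moll η g x‖ₑ ≤ ENNReal.ofReal (∫ x in Ω, |g x|) := by
  have hg := integrable_indicator_L2 hopen hbdd g
  have hη := η.integrable_normed (μ := volume)
  have hle (x : E n) : |moll η g x| ≤ (η.normed volume
      ⋆[ContinuousLinearMap.lsmul ℝ ℝ, volume] fun y => |Ω.indicator g y|) x := by
    rw [moll, convolution_def, convolution_def]
    refine (abs_integral_le_integral_abs).trans_eq (integral_congr_ae (Eventually.of_forall ?_))
    intro y
    simp [abs_mul, abs_of_nonneg (η.nonneg_normed y)]
  have hint := hη.integrable_convolution (ContinuousLinearMap.lsmul ℝ ℝ) hg.abs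
  calc ∫⁻ x, ‖moll η g x‖ₑ ≤ ∫⁻ x, ENNReal.ofReal ((η.normed volume
        ⋆[ContinuousLinearMap.lsmul ℝ ℝ, volume] fun y => |Ω.indicator g y|) x) :=
        lintegral_mono fun x => by
          rw [Real.enorm_eq_ofReal_abs]; exact ENNReal.ofReal_le_ofReal (hle x)
    _ = ENNReal.ofReal (∫ x, (η.normed volume
        ⋆[ContinuousLinearMap.lsmul ℝ ℝ, volume] fun y => |Ω.indicator g y|) x) :=
        (ofReal_integral_eq_lintegral_ofReal hint
          (Eventually.of_forall fun x => (abs_nonneg _).trans (hle x))).symm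
    _ = ENNReal.ofReal (∫ x in Ω, |g x|) := by
        rw [integral_convolution _ hη hg.abs, η.integral_normed,
          ← integral_indicator hopen.measurableSet]
        congr 1
        simp only [ContinuousLinearMap.lsmul_apply, one_smul]
        refine integral_congr_ae (Eventually.of_forall fun y => ?_)
        by_cases hy : y ∈ Ω <;> simp [hy]

end Mollifier

/-! ### Pointwise bounds by integrals over `Ω` -/

theorem integral_abs_mul_abs_le {Ω : Set (E n)} (f g : L2 Ω) :
    ∫ x in Ω, |f x| * |g x| ≤ ‖f‖ * ‖g‖ := by
  have h : ∫ x in Ω, |f x| * |g x| = inner ℝ |f| |g| := by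
    rw [L2.inner_def]
    refine integral_congr_ae ?_
    filter_upwards [Lp.coeFn_abs f, Lp.coeFn_abs g] with x hf hg
    simp [hf, hg, mul_comm]
  rw [h]
  simpa [norm_abs_eq_norm] using real_inner_le_norm |f| |g|

theorem exists_integral_abs_le_norm {Ω : Set (E n)} (hbdd : Bornology.IsBounded Ω) :
    ∃ M : ℝ, 0 ≤ M ∧ ∀ g : L2 Ω, ∫ x in Ω, |g x| ≤ M * ‖g‖ := by
  have := isFiniteMeasure_restrict_of_isBounded hbdd
  have h1 : MemLp (fun _ : E n => (1 : ℝ)) 2 (volume.restrict Ω) := memLp_const 1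
  refine ⟨‖h1.toLp‖, norm_nonneg _, fun g => (integral_abs_mul_abs_le h1.toLp g).trans_eq' ?_⟩
  refine integral_congr_ae ?_
  filter_upwards [h1.coeFn_toLp] with x hx
  rw [hx, abs_one, one_mul]

/-- A one-dimensional trace inequality. -/
theorem abs_le_integral_abs_add_abs_deriv {f f' : ℝ → ℝ} (hf : Continuous f) (hf' : Continuous f')
    (h : ∀ s ∈ Icc (0 : ℝ) 1, HasDerivAt f (f' s) s) :
    |f 0| ≤ ∫ s in Ioc (0 : ℝ) 1, (|f s| + |f' s|) := by
  have hi (g : ℝ → ℝ) (hg : Continuous g) : IntegrableOn g (Ioc 0 1) :=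
    (hg.integrableOn_Icc).mono_set Ioc_subset_Icc_self
  have key : ∀ s ∈ Ioc (0 : ℝ) 1, |f 0| - |f s| ≤ ∫ τ in Ioc (0 : ℝ) 1, |f' τ| := by
    intro s hs
    have h1 : ∫ τ in (0 : ℝ)..s, f' τ = f s - f 0 :=
      intervalIntegral.integral_eq_sub_of_hasDerivAt (fun τ hτ => h τ (by
        rw [uIcc_of_le hs.1.le] at hτ
        exact ⟨hτ.1, hτ.2.trans hs.2⟩)) (hf'.intervalIntegrable _ _)
    calc |f 0| - |f s| ≤ |f s - f 0| := by
          rw [abs_sub_comm]; exact abs_sub_abs_le_abs_sub _ _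
      _ ≤ ∫ τ in Ioc 0 s, |f' τ| := by
          rw [← h1, intervalIntegral.integral_of_le hs.1.le]
          exact abs_integral_le_integral_abs
      _ ≤ ∫ τ in Ioc (0 : ℝ) 1, |f' τ| :=
          setIntegral_mono_set (hi _ hf'.abs) (Eventually.of_forall fun _ => abs_nonneg _)
            (Ioc_subset_Ioc_right hs.2).eventuallyLE
  -- Averaging `key` over `s` in the unit interval replaces `|f s|` by its integral.
  have h2 := setIntegral_mono_on ((integrable_const |f 0|).sub (hi _ hf.abs))
    (integrable_const (∫ τ in Ioc (0 : ℝ) 1, |f' τ|)) measurableSet_Ioc key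
  rw [integral_sub' (integrable_const _) (hi _ hf.abs)] at h2
  rw [integral_add (hi _ hf.abs) (hi _ hf'.abs)]
  simp at h2
  linarith

theorem integrable_box {Φ : ℝ × ℝ → ℝ} (hΦ : Continuous Φ) :
    Integrable Φ ((volume.restrict (Ioc (0 : ℝ) 1)).prod (volume.restrict (Ioc (0 : ℝ) 1))) := by
  rw [Measure.prod_restrict]
  exact (hΦ.continuousOn.integrableOn_compact (isCompact_Icc.prod isCompact_Icc)).mono_set
    (prod_mono Ioc_subset_Icc_self Ioc_subset_Icc_self)

/-- The density bound `K` turns the integral over the square into one over all of `ℝⁿ`; translation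
invariance then removes `x`, so the bound is uniform in `x`. -/
theorem integral_box_abs_moll_le {Ω : Set (E n)} (hopen : IsOpen Ω)
    (hbdd : Bornology.IsBounded Ω) (η : ContDiffBump (0 : E n)) {a b : E n} {K : ℝ≥0}
    (hK : Spreads a b K) (g : L2 Ω) (x : E n) :
    ∫ q : ℝ × ℝ, |moll η g (x + (q.1 • a + q.2 • b))|
      ∂((volume.restrict (Ioc (0 : ℝ) 1)).prod (volume.restrict (Ioc (0 : ℝ) 1)))
      ≤ K * ∫ y in Ω, |g y| := by
  have hm := continuous_moll hopen hbdd η g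
  have hg : 0 ≤ ∫ y in Ω, |g y| := integral_nonneg fun _ => abs_nonneg _
  have hi := integrable_box (Φ := fun q : ℝ × ℝ => moll η g (x + (q.1 • a + q.2 • b)))
    (by fun_prop)
  simp only [← Real.norm_eq_abs (moll _ _ _)]
  rw [integral_norm_eq_lintegral_enorm hi.1]
  refine ENNReal.toReal_le_of_le_ofReal (by positivity) ?_
  calc ∫⁻ q : ℝ × ℝ, ‖moll η g (x + (q.1 • a + q.2 • b))‖ₑ
      ∂((volume.restrict (Ioc (0 : ℝ) 1)).prod (volume.restrict (Ioc (0 : ℝ) 1)))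
      = ∫⁻ z, ‖moll η g (x + z)‖ₑ ∂(((volume.restrict (Ioc (0 : ℝ) 1)).prod
          (volume.restrict (Ioc (0 : ℝ) 1))).map fun q : ℝ × ℝ => q.1 • a + q.2 • b) := by
        rw [lintegral_map]
        · exact (hm.comp (continuous_const.add continuous_id)).measurable.enorm
        · fun_prop
    _ ≤ ∫⁻ z, ‖moll η g (x + z)‖ₑ ∂(K • (volume : Measure (E n))) := lintegral_mono' hK le_rfl
    _ = K * ∫⁻ z, ‖moll η g z‖ₑ := by
        rw [lintegral_smul_measure, lintegral_add_left_eq_self (fun z => ‖moll η g z‖ₑ) x]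
        rfl
    _ ≤ K * ENNReal.ofReal (∫ y in Ω, |g y|) := by
        gcongr; exact lintegral_enorm_moll_le hopen hbdd η g
    _ = ENNReal.ofReal (K * ∫ y in Ω, |g y|) := by
        rw [ENNReal.ofReal_mul K.coe_nonneg, ENNReal.ofReal_coe_nnreal]

/-- The trace inequality along `a` leaves line integrals of `f` and `fa`; applied along `b` at each
point of the line, it turns them into integrals over the parallelogram. Only the mixed second
derivative appears. -/
theorem abs_moll_le {Ω : Set (E n)} (hopen : IsOpen Ω) (hbdd : Bornology.IsBounded Ω)
    (η : ContDiffBump (0 : E n)) {a b : E n} {K : ℝ≥0} (hK : Spreads a b K)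
    {f fa fb fab : L2 Ω} (hfa : HasWeakDeriv Ω a f fa) (hfb : HasWeakDeriv Ω b f fb)
    (hfab : HasWeakDeriv Ω b fa fab) {x : E n}
    (hx : ∀ s ∈ Icc (0 : ℝ) 1, ∀ t ∈ Icc (0 : ℝ) 1,
      Metric.closedBall (x + (s • a + t • b)) η.rOut ⊆ Ω) :
    |moll η f x| ≤ K * ((∫ y in Ω, |f y|) + (∫ y in Ω, |fb y|) + (∫ y in Ω, |fa y|)
      + ∫ y in Ω, |fab y|) := by
  have hm := continuous_moll hopen hbdd η (Ω := Ω)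
  have hmc (g : L2 Ω) : Continuous fun q : ℝ × ℝ => |moll η g (x + (q.1 • a + q.2 • b))| := by
    have := hm g
    fun_prop
  have inner {g gb : L2 Ω} (h : HasWeakDeriv Ω b g gb) {s : ℝ} (hs : s ∈ Icc (0 : ℝ) 1) :
      |moll η g (x + s • a)| ≤ ∫ t in Ioc (0 : ℝ) 1,
        (|moll η g (x + (s • a + t • b))| + |moll η gb (x + (s • a + t • b))|) := by
    have := hm g
    have := hm gb
    have h1 := abs_le_integral_abs_add_abs_deriv
      (f := fun t : ℝ => moll η g (x + s • a + t • b))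
      (f' := fun t : ℝ => moll η gb (x + s • a + t • b)) (by fun_prop) (by fun_prop)
      (fun t ht => hasDerivAt_moll hopen hbdd η h (by rw [add_assoc]; exact hx s hs t ht))
    simpa only [zero_smul, add_zero, add_assoc] using h1
  have outer : |moll η f x| ≤ ∫ s in Ioc (0 : ℝ) 1,
      (|moll η f (x + s • a)| + |moll η fa (x + s • a)|) := by
    have := hm f
    have := hm fa
    have h1 := abs_le_integral_abs_add_abs_deriv (f := fun s : ℝ => moll η f (x + s • a))
      (f' := fun s : ℝ => moll η fa (x + s • a)) (by fun_prop) (by fun_prop)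
      (fun s hs => hasDerivAt_moll hopen hbdd η hfa (by simpa using hx s hs 0 (by simp)))
    simpa only [zero_smul, add_zero] using h1
  have hi (g : L2 Ω) := integrable_box (hmc g)
  have split {g gb : L2 Ω} (h : HasWeakDeriv Ω b g gb) :
      ∫ s in Ioc (0 : ℝ) 1, |moll η g (x + s • a)|
        ≤ K * ((∫ y in Ω, |g y|) + ∫ y in Ω, |gb y|) := by
    have := hm g
    calc ∫ s in Ioc (0 : ℝ) 1, |moll η g (x + s • a)|
        ≤ ∫ s in Ioc (0 : ℝ) 1, ∫ t in Ioc (0 : ℝ) 1,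
          (|moll η g (x + (s • a + t • b))| + |moll η gb (x + (s • a + t • b))|) := by
          refine setIntegral_mono_on ?_ ((hi g).add (hi gb)).integral_prod_left measurableSet_Ioc
            fun s hs => inner h (Ioc_subset_Icc_self hs)
          exact (Continuous.integrableOn_Icc (by fun_prop)).mono_set Ioc_subset_Icc_self
      _ ≤ K * ((∫ y in Ω, |g y|) + ∫ y in Ω, |gb y|) := by
          rw [mul_add]
          refine (integral_prod _ ((hi g).add (hi gb))).symm.trans_le ?_
          exact (integral_add (hi g) (hi gb)).trans_le (add_le_add
            (integral_box_abs_moll_le hopen hbdd η hK g x)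
            (integral_box_abs_moll_le hopen hbdd η hK gb x))
  have hline (g : L2 Ω) : IntegrableOn (fun s : ℝ => |moll η g (x + s • a)|) (Ioc 0 1) := by
    have := hm g
    exact (Continuous.integrableOn_Icc (by fun_prop)).mono_set Ioc_subset_Icc_self
  rw [integral_add (hline f) (hline fa)] at outer
  linarith [split hfb, split hfab]

/-! ### The embedding of `H²(Ω)` into `L^∞(Ω)` -/

theorem H1.norm_fn_le {Ω : Set (E n)} (u : H1 Ω) : ‖H1.fn u‖ ≤ ‖u‖ :=
  WithLp.norm_fst_le (p := 2) _ u.1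

theorem H1.norm_grad_le {Ω : Set (E n)} (u : H1 Ω) (i : Fin n) : ‖H1.grad u i‖ ≤ ‖u‖ :=
  (PiLp.norm_apply_le (p := 2) u.1.snd i).trans (WithLp.norm_snd_le (p := 2) _ u.1)

theorem H1.hasWeakPartial {Ω : Set (E n)} (u : H1 Ω) (i : Fin n) :
    HasWeakPartial Ω i (H1.fn u) (H1.grad u i) :=
  u.2 i

theorem norm_sum_smul_le {V ι : Type*} [SeminormedAddCommGroup V] [NormedSpace ℝ V] [Fintype ι]
    (c : ι → ℝ) {g : ι → V} {M : ℝ} (hg : ∀ i, ‖g i‖ ≤ M) :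
    ‖∑ i, c i • g i‖ ≤ (∑ i, |c i|) * M := by
  rw [Finset.sum_mul]
  refine norm_sum_le_of_le _ fun i _ => ?_
  rw [norm_smul, Real.norm_eq_abs]
  exact mul_le_mul_of_nonneg_left (hg i) (abs_nonneg _)

/-- A bump function supported in the ball of radius `2 / (k + 1)`. -/
def shrinkingBump (n k : ℕ) : ContDiffBump (0 : E n) where
  rIn := 1 / ((k : ℝ) + 1)
  rOut := 2 * (1 / ((k : ℝ) + 1))
  rIn_pos := by positivity
  rIn_lt_rOut := by
    have : 0 < 1 / ((k : ℝ) + 1) := by positivity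
    linarith

theorem tendsto_rOut_shrinkingBump (n : ℕ) :
    Tendsto (fun k => (shrinkingBump n k).rOut) atTop (𝓝 0) := by
  have := (tendsto_one_div_add_atTop_nhds_zero_nat (𝕜 := ℝ)).const_mul 2
  rwa [mul_zero] at this

theorem exists_local_sup_bound (hn : n = 1 ∨ n = 2) {Ω : Set (E n)} (hopen : IsOpen Ω)
    (hbdd : Bornology.IsBounded Ω) (hsmooth : HasSmoothBoundary Ω) {p : E n}
    (hp : p ∈ closure Ω) :
    ∃ V ∈ 𝓝 p, ∃ C : ℝ, 0 ≤ C ∧ ∀ u : H2 Ω, ∀ᵐ x ∂volume.restrict Ω,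
      x ∈ V → |H2.fn u x| ≤ C * ‖u‖ := by
  obtain ⟨V, hV, a, b, K, hK, hcone⟩ := exists_spreading_cone hn hopen hsmooth hp
  obtain ⟨M, hM0, hM⟩ := exists_integral_abs_le_norm hbdd
  set A := ∑ i, |a i|
  set B := ∑ i, |b i|
  have hA : 0 ≤ A := Finset.sum_nonneg fun _ _ => abs_nonneg _
  have hB : 0 ≤ B := Finset.sum_nonneg fun _ _ => abs_nonneg _
  refine ⟨V, hV, K * (M * (1 + B + A + B * A)), by positivity, fun u => ?_⟩
  have hu1 : ‖u.1.fst‖ ≤ ‖u‖ := WithLp.norm_fst_le (p := 2) _ u.1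
  have hu2 (i j : Fin n) : ‖u.1.snd (i, j)‖ ≤ ‖u‖ :=
    (PiLp.norm_apply_le (p := 2) u.1.snd (i, j)).trans (WithLp.norm_snd_le (p := 2) _ u.1)
  let f : L2 Ω := H2.fn u
  let fa : L2 Ω := ∑ i, a i • H1.grad u.1.fst i
  let fb : L2 Ω := ∑ i, b i • H1.grad u.1.fst i
  let fab : L2 Ω := ∑ j, b j • ∑ i, a i • u.1.snd (i, j)
  have hfa : HasWeakDeriv Ω a f fa := .of_partial (H1.hasWeakPartial u.1.fst) a
  have hfb : HasWeakDeriv Ω b f fb := .of_partial (H1.hasWeakPartial u.1.fst) b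
  have hfab : HasWeakDeriv Ω b fa fab :=
    .of_partial (fun j => HasWeakPartial.sum _ fun i => (u.2 i j).smul (a i)) b
  have nf : ‖f‖ ≤ ‖u‖ := (H1.norm_fn_le _).trans hu1
  have nfa : ‖fa‖ ≤ A * ‖u‖ := norm_sum_smul_le a fun i => (H1.norm_grad_le _ i).trans hu1
  have nfb : ‖fb‖ ≤ B * ‖u‖ := norm_sum_smul_le b fun i => (H1.norm_grad_le _ i).trans hu1
  have nfab : ‖fab‖ ≤ B * (A * ‖u‖) :=
    norm_sum_smul_le b fun j => norm_sum_smul_le a fun i => hu2 i j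
  -- Lebesgue differentiation recovers `f x` a.e. as a limit of mollifications; `K := 2` is the
  -- fixed ratio of outer to inner radius.
  have hlim := ContDiffBump.ae_convolution_tendsto_right_of_locallyIntegrable
    (μ := (volume : Measure (E n))) (φ := fun k => shrinkingBump n k) (K := 2)
    (tendsto_rOut_shrinkingBump n) (Eventually.of_forall fun k => le_rfl)
    (integrable_indicator_L2 hopen hbdd f).locallyIntegrable
  filter_upwards [ae_restrict_of_ae hlim, ae_restrict_mem hopen.measurableSet] with x hx hxΩ hxV
  rw [indicator_of_mem hxΩ] at hx
  refine le_of_tendsto hx.abs ?_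
  have hcomp : IsCompact ((fun q : ℝ × ℝ => x + (q.1 • a + q.2 • b)) '' (Icc 0 1 ×ˢ Icc 0 1)) :=
    (isCompact_Icc.prod isCompact_Icc).image (by fun_prop)
  -- The parallelogram at `x` is compact, so it has positive room in `Ω` and the bumps eventually
  -- fit. How much room depends on `x`, but the bound does not.
  obtain ⟨ε, hε, hsub⟩ := hcomp.exists_cthickening_subset_open hopen (by
    rintro _ ⟨q, hq, rfl⟩
    exact hcone x ⟨hxV, hxΩ⟩ _ hq.1 _ hq.2)
  filter_upwards [(tendsto_rOut_shrinkingBump n).eventually_le_const hε] with k hk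
  have hball : ∀ s ∈ Icc (0 : ℝ) 1, ∀ t ∈ Icc (0 : ℝ) 1,
      Metric.closedBall (x + (s • a + t • b)) (shrinkingBump n k).rOut ⊆ Ω := fun s hs t ht =>
    (Metric.closedBall_subset_closedBall hk).trans
      ((Metric.closedBall_subset_cthickening
        (mem_image_of_mem (fun q : ℝ × ℝ => x + (q.1 • a + q.2 • b)) (mk_mem_prod hs ht)) ε).trans
        hsub)
  calc |moll (shrinkingBump n k) f x|
      ≤ K * ((∫ y in Ω, |f y|) + (∫ y in Ω, |fb y|) + (∫ y in Ω, |fa y|)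
        + ∫ y in Ω, |fab y|) := abs_moll_le hopen hbdd _ hK hfa hfb hfab hball
    _ ≤ K * (M * ‖u‖ + M * (B * ‖u‖) + M * (A * ‖u‖) + M * (B * (A * ‖u‖))) := by
        gcongr
        · exact (hM f).trans (by gcongr)
        · exact (hM fb).trans (by gcongr)
        · exact (hM fa).trans (by gcongr)
        · exact (hM fab).trans (by gcongr)
    _ = K * (M * (1 + B + A + B * A)) * ‖u‖ := by ring

/-- The Sobolev embedding `H²(Ω) ⊂ L^∞(Ω)` in dimensions one and two. -/
theorem exists_sup_bound (hn : n = 1 ∨ n = 2) {Ω : Set (E n)} (hopen : IsOpen Ω)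
    (hbdd : Bornology.IsBounded Ω) (hsmooth : HasSmoothBoundary Ω) :
    ∃ C : ℝ, 0 < C ∧ ∀ u : H2 Ω, ∀ᵐ x ∂volume.restrict Ω, |H2.fn u x| ≤ C * ‖u‖ := by
  obtain ⟨C, hC, h⟩ : ∃ C : ℝ, 0 ≤ C ∧ ∀ u : H2 Ω, ∀ᵐ x ∂volume.restrict Ω,
      x ∈ closure Ω → |H2.fn u x| ≤ C * ‖u‖ := by
    refine hbdd.isCompact_closure.induction_on
      (p := fun s => ∃ C : ℝ, 0 ≤ C ∧ ∀ u : H2 Ω, ∀ᵐ x ∂volume.restrict Ω,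
        x ∈ s → |H2.fn u x| ≤ C * ‖u‖) ⟨0, le_rfl, by simp⟩ ?_ ?_ ?_
    · rintro s t hst ⟨C, hC, h⟩
      exact ⟨C, hC, fun u => (h u).mono fun x hx hxs => hx (hst hxs)⟩
    · rintro s t ⟨C, hC, h⟩ ⟨D, hD, h'⟩
      refine ⟨C + D, by positivity, fun u => ?_⟩
      filter_upwards [h u, h' u] with x hx hx' hxst
      have h1 : 0 ≤ C * ‖u‖ := by positivity
      have h2 : 0 ≤ D * ‖u‖ := by positivity
      rw [add_mul]
      rcases hxst with hxs | hxt
      · linarith [hx hxs]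
      · linarith [hx' hxt]
    · intro p hp
      obtain ⟨V, hV, C, hC⟩ := exists_local_sup_bound hn hopen hbdd hsmooth hp
      exact ⟨V, mem_nhdsWithin_of_mem_nhds hV, C, hC⟩
  refine ⟨C + 1, by positivity, fun u => ?_⟩
  filter_upwards [h u, ae_restrict_mem hopen.measurableSet] with x hx hxΩ
  exact (hx (subset_closure hxΩ)).trans (by gcongr; linarith)

/-! ### Completeness of the Sobolev spaces -/

section Completeness

variable {Ω : Set (E n)}

theorem continuous_pderiv {φ : E n → ℝ} (hφ : IsTestFunction Ω φ) (i : Fin n) :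
    Continuous (pderiv i φ) :=
  (hφ.contDiff.continuous_fderiv (by simp)).clm_apply continuous_const

theorem hasCompactSupport_pderiv {φ : E n → ℝ} (hφ : IsTestFunction Ω φ) (i : Fin n) :
    HasCompactSupport (pderiv i φ) :=
  hφ.hasCompactSupport.fderiv_apply ℝ _

/-- Each weak derivative identity compares inner products with fixed `L²` functions, hence is a
closed condition. -/
theorem isClosed_H1 : IsClosed (H1 Ω : Set (WithLp 2 (L2 Ω × PiLp 2 fun _ : Fin n => L2 Ω))) := by
  have : (H1 Ω : Set (WithLp 2 (L2 Ω × PiLp 2 fun _ : Fin n => L2 Ω))) =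
      ⋂ (i : Fin n) (φ : E n → ℝ) (_ : IsTestFunction Ω φ),
        {z | ∫ x in Ω, z.fst x * pderiv i φ x = -∫ x in Ω, z.snd i x * φ x} := by
    ext z
    simp only [mem_iInter]
    rfl
  rw [this]
  refine isClosed_iInter fun i => isClosed_iInter fun φ => isClosed_iInter fun hφ => ?_
  have h1 : MemLp (pderiv i φ) 2 (volume.restrict Ω) :=
    (continuous_pderiv hφ i).memLp_of_hasCompactSupport (hasCompactSupport_pderiv hφ i)
  have h2 := hφ.memLp (volume.restrict Ω)
  simp only [integral_mul_eq_inner h1, integral_mul_eq_inner h2]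
  exact isClosed_eq (by fun_prop) (by fun_prop)

instance : CompleteSpace (H1 Ω) := isClosed_H1.completeSpace_coe

instance : CompleteSpace (H10 Ω) :=
  (Submodule.isClosed_topologicalClosure (testSubmodule Ω)).completeSpace_coe

theorem H1.norm_sq (u : H1 Ω) : ‖u‖ ^ 2 = ‖H1.fn u‖ ^ 2 + ∑ i, ‖H1.grad u i‖ ^ 2 := by
  have h := WithLp.prod_norm_sq_eq_of_L2 u.1
  rw [PiLp.norm_sq_eq_of_L2] at h
  exact h

theorem H1.continuous_fn : Continuous (H1.fn : H1 Ω → L2 Ω) := by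
  unfold H1.fn; fun_prop

theorem H1.continuous_grad (i : Fin n) : Continuous fun u : H1 Ω => H1.grad u i := by
  unfold H1.grad; fun_prop

end Completeness

/-! ### The Poincaré inequality -/

theorem IsTestFunction.coord_mul {Ω : Set (E n)} {φ : E n → ℝ} (hφ : IsTestFunction Ω φ)
    (i : Fin n) : IsTestFunction Ω fun x => x i * φ x where
  contDiff := by
    have := hφ.contDiff
    fun_prop
  hasCompactSupport := hφ.hasCompactSupport.mul_left
  tsupport_subset := (tsupport_mul_subset_right (f := fun x : E n => x i)).trans hφ.tsupport_subset

theorem IsTestFunction.setIntegral_mul_eq {Ω : Set (E n)} {φ : E n → ℝ}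
    (hφ : IsTestFunction Ω φ) (f : E n → ℝ) : ∫ x in Ω, φ x * f x = ∫ x, φ x * f x := by
  refine setIntegral_eq_integral_of_forall_compl_eq_zero fun x hx => ?_
  rw [image_eq_zero_of_notMem_tsupport fun h => hx (hφ.tsupport_subset h), zero_mul]

/-- Since `∂ᵢ(xᵢφ) = φ + xᵢ∂ᵢφ`, integrating `φ ∂ᵢ(xᵢφ)` by parts gives the negative of `∫ xᵢφ∂ᵢφ`,
while expanding gives `∫ φ²` plus that integral. The derivative is kept on `xᵢφ` so that the weak
derivative of `u` can be tested against it. -/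
theorem IsTestFunction.integral_sq {Ω : Set (E n)} {φ : E n → ℝ} (hφ : IsTestFunction Ω φ)
    (i : Fin n) :
    ∫ x in Ω, φ x * φ x = 2 * ∫ x in Ω, φ x * pderiv i (fun x => x i * φ x) x := by
  have hψ := hφ.coord_mul i
  have hd := hφ.contDiff.differentiable (by simp)
  have hψd := hψ.contDiff.differentiable (by simp)
  have hcφ := hφ.contDiff.continuous
  have hcψ := hψ.contDiff.continuous
  have hcd := continuous_pderiv hφ i
  have hcd' := continuous_pderiv hψ i
  have hprod (x : E n) : pderiv i (fun x => x i * φ x) x = φ x + x i * pderiv i φ x := by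
    have h1 : HasFDerivAt (fun x : E n => x i) (EuclideanSpace.proj i : E n →L[ℝ] ℝ) x :=
      (EuclideanSpace.proj i : E n →L[ℝ] ℝ).hasFDerivAt
    rw [pderiv, (h1.fun_mul (hd x).hasFDerivAt).fderiv]
    simp [pderiv]
    ring
  have hint {f g : E n → ℝ} (hf : Continuous f) (hg : Continuous g) (hs : HasCompactSupport g) :
      Integrable (fun x => f x * g x) (volume : Measure (E n)) :=
    (hf.mul hg).integrable_of_hasCompactSupport hs.mul_left
  have ibp : ∫ x, φ x * pderiv i (fun x => x i * φ x) x = -∫ x, pderiv i φ x * (x i * φ x) :=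
    integral_mul_fderiv_eq_neg_fderiv_mul_of_integrable
      (hint hcd hcψ hψ.hasCompactSupport)
      (hint hcφ hcd' (hasCompactSupport_pderiv hψ i))
      (hint hcφ hcψ hψ.hasCompactSupport) (fun x _ => hd x) (fun x _ => hψd x)
  have hsplit : ∫ x, φ x * pderiv i (fun x => x i * φ x) x
      = (∫ x, φ x * φ x) + ∫ x, pderiv i φ x * (x i * φ x) := by
    rw [← integral_add (hint hcφ hcφ hφ.hasCompactSupport) (hint hcd hcψ hψ.hasCompactSupport)]
    refine integral_congr_ae (Eventually.of_forall fun x => ?_)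
    simp only [hprod]
    ring
  rw [hφ.setIntegral_mul_eq, hφ.setIntegral_mul_eq]
  linarith

theorem norm_sq_eq_integral {Ω : Set (E n)} (f : L2 Ω) : ‖f‖ ^ 2 = ∫ x in Ω, f x * f x := by
  rw [← real_inner_self_eq_norm_sq, L2.inner_def]
  rfl

/-- Testing with `xᵢφ` gives `‖u‖² = -2 ∫ ∂ᵢu xᵢ u`; then `|xᵢ| ≤ R` and Cauchy–Schwarz apply. The
weak gradient of `u` never has to be identified with the classical one of `φ`. -/
theorem norm_fn_le_of_mem_testSubmodule {Ω : Set (E n)} (hopen : IsOpen Ω) {R : ℝ} (hR0 : 0 ≤ R)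
    (hR : ∀ x ∈ Ω, ‖x‖ ≤ R) (i : Fin n) {u : H1 Ω} (hu : u ∈ testSubmodule Ω) :
    ‖H1.fn u‖ ≤ 2 * R * ‖H1.grad u i‖ := by
  obtain ⟨φ, hφ, huφ⟩ := hu
  have hsq : ‖H1.fn u‖ ^ 2 = 2 * -∫ x in Ω, H1.grad u i x * (x i * φ x) := by
    rw [norm_sq_eq_integral, ← H1.hasWeakPartial u i _ (hφ.coord_mul i)]
    refine Eq.trans ?_ ((hφ.integral_sq i).trans ?_)
    · refine integral_congr_ae ?_
      filter_upwards [huφ] with x hx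
      rw [hx]
    · congr 1
      refine integral_congr_ae ?_
      filter_upwards [huφ] with x hx
      rw [hx]
  have hint : Integrable (fun x => |H1.fn u x| * |H1.grad u i x|) (volume.restrict Ω) :=
    (Lp.memLp (H1.fn u)).abs.integrable_mul (Lp.memLp (H1.grad u i)).abs
  have hle : -∫ x in Ω, H1.grad u i x * (x i * φ x)
      ≤ R * ∫ x in Ω, |H1.fn u x| * |H1.grad u i x| := by
    rw [← integral_const_mul]
    refine (neg_le_abs _).trans (abs_integral_le_integral_abs.trans ?_)
    refine integral_mono_ae ((hφ.coord_mul i).integrable_mul _).abs (hint.const_mul R) ?_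
    filter_upwards [huφ, ae_restrict_mem hopen.measurableSet] with x hx hxΩ
    have h1 : |x i| ≤ R := (PiLp.norm_apply_le x i).trans (hR x hxΩ)
    rw [abs_mul, abs_mul, hx]
    calc |H1.grad u i x| * (|x i| * |φ x|) ≤ |H1.grad u i x| * (R * |φ x|) := by gcongr
      _ = R * (|φ x| * |H1.grad u i x|) := by ring
  have hcs := integral_abs_mul_abs_le (H1.fn u) (H1.grad u i)
  have hfin : ‖H1.fn u‖ * ‖H1.fn u‖ ≤ (2 * R * ‖H1.grad u i‖) * ‖H1.fn u‖ := by
    nlinarith [mul_le_mul_of_nonneg_left hcs hR0]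
  rcases (norm_nonneg (H1.fn u)).eq_or_lt with h | h
  · rw [← h]; positivity
  · exact le_of_mul_le_mul_right hfin h

/-- The Poincaré inequality on `H¹₀(Ω)`. -/
theorem exists_poincare (hn : 0 < n) {Ω : Set (E n)} (hopen : IsOpen Ω)
    (hbdd : Bornology.IsBounded Ω) :
    ∃ P : ℝ, 0 < P ∧ ∀ u : H10 Ω, ‖u‖ ^ 2 ≤ P * ∑ i, ‖H1.grad u.1 i‖ ^ 2 := by
  obtain ⟨R, hR0, hR⟩ := hbdd.exists_pos_norm_le
  let i₀ : Fin n := ⟨0, hn⟩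
  refine ⟨(2 * R) ^ 2 + 1, by positivity, fun u => ?_⟩
  -- Both sides are continuous in the `H¹` norm, so the inequality passes to the closure.
  have hmem : (u : H1 Ω) ∈ {u : H1 Ω | ‖H1.fn u‖ ≤ 2 * R * ‖H1.grad u i₀‖} :=
    closure_minimal (fun z hz => norm_fn_le_of_mem_testSubmodule hopen hR0.le hR i₀ hz)
      (isClosed_le H1.continuous_fn.norm ((H1.continuous_grad i₀).norm.const_mul _)) u.2
  have h1 : ‖H1.fn u.1‖ ^ 2 ≤ (2 * R) ^ 2 * ‖H1.grad u.1 i₀‖ ^ 2 := by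
    rw [← mul_pow]; exact pow_le_pow_left₀ (norm_nonneg _) hmem 2
  have h2 : ‖H1.grad u.1 i₀‖ ^ 2 ≤ ∑ i, ‖H1.grad u.1 i‖ ^ 2 :=
    Finset.single_le_sum (f := fun i => ‖H1.grad u.1 i‖ ^ 2) (fun _ _ => sq_nonneg _)
      (Finset.mem_univ i₀)
  have h3 := mul_le_mul_of_nonneg_left h2 (sq_nonneg (2 * R))
  rw [show ‖u‖ = ‖u.1‖ from rfl, H1.norm_sq]
  linarith

/-! ### The weighted gradient form -/

section EllipticForm

variable {Ω : Set (E n)}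

/-- The bilinear form `∫_Ω c ∇u·∇φ`. -/
def gradForm (c : E n → ℝ) (u φ : H1 Ω) : ℝ :=
  ∫ x in Ω, c x * ∑ i, H1.grad u i x * H1.grad φ i x

theorem integrable_grad_mul_grad (u φ : H1 Ω) (i : Fin n) :
    Integrable (fun x => H1.grad u i x * H1.grad φ i x) (volume.restrict Ω) :=
  (Lp.memLp (H1.grad u i)).integrable_mul (Lp.memLp (H1.grad φ i))

theorem integrable_gradForm {c : E n → ℝ} {M : ℝ}
    (hc : AEStronglyMeasurable c (volume.restrict Ω))
    (hM : ∀ᵐ x ∂volume.restrict Ω, |c x| ≤ M) (u φ : H1 Ω) :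
    Integrable (fun x => c x * ∑ i, H1.grad u i x * H1.grad φ i x) (volume.restrict Ω) :=
  (integrable_finsetSum _ fun i _ => integrable_grad_mul_grad u φ i).bdd_mul hc hM

theorem gradForm_comm (c : E n → ℝ) (u φ : H1 Ω) : gradForm c u φ = gradForm c φ u := by
  simp only [gradForm, mul_comm (H1.grad u _ _)]

theorem gradForm_add_left {c : E n → ℝ} {M : ℝ}
    (hc : AEStronglyMeasurable c (volume.restrict Ω))
    (hM : ∀ᵐ x ∂volume.restrict Ω, |c x| ≤ M) (u v φ : H1 Ω) :
    gradForm c (u + v) φ = gradForm c u φ + gradForm c v φ := by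
  rw [gradForm, gradForm, gradForm,
    ← integral_add (integrable_gradForm hc hM u φ) (integrable_gradForm hc hM v φ)]
  refine integral_congr_ae ?_
  filter_upwards [ae_all_iff.2 fun i => Lp.coeFn_add (H1.grad u i) (H1.grad v i)] with x hx
  have h (i : Fin n) : H1.grad (u + v) i x = H1.grad u i x + H1.grad v i x := hx i
  simp only [h, add_mul, Finset.sum_add_distrib, mul_add]

theorem gradForm_smul_left (c : E n → ℝ) (k : ℝ) (u φ : H1 Ω) :
    gradForm c (k • u) φ = k * gradForm c u φ := by
  rw [gradForm, gradForm, ← integral_const_mul]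
  refine integral_congr_ae ?_
  filter_upwards [ae_all_iff.2 fun i => Lp.coeFn_smul k (H1.grad u i)] with x hx
  have h (i : Fin n) : H1.grad (k • u) i x = k * H1.grad u i x := hx i
  simp only [h, mul_assoc, ← Finset.mul_sum]
  ring

theorem abs_gradForm_le {c : E n → ℝ} {M : ℝ} (hM0 : 0 ≤ M)
    (hc : AEStronglyMeasurable c (volume.restrict Ω))
    (hM : ∀ᵐ x ∂volume.restrict Ω, |c x| ≤ M) (u φ : H1 Ω) :
    |gradForm c u φ| ≤ M * n * ‖u‖ * ‖φ‖ := by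
  have hi (i : Fin n) : Integrable (fun x => |H1.grad u i x| * |H1.grad φ i x|)
      (volume.restrict Ω) := by
    simpa only [abs_mul] using (integrable_grad_mul_grad u φ i).abs
  calc |gradForm c u φ| ≤ ∫ x in Ω, |c x * ∑ i, H1.grad u i x * H1.grad φ i x| :=
        abs_integral_le_integral_abs
    _ ≤ ∫ x in Ω, M * ∑ i, |H1.grad u i x| * |H1.grad φ i x| := by
        refine integral_mono_ae (integrable_gradForm hc hM u φ).abs
          ((integrable_finsetSum _ fun i _ => hi i).const_mul M) ?_
        filter_upwards [hM] with x hx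
        rw [abs_mul]
        simp only [← abs_mul (H1.grad _ _ _)]
        exact mul_le_mul hx (Finset.abs_sum_le_sum_abs _ _) (abs_nonneg _) hM0
    _ = M * ∑ i, ∫ x in Ω, |H1.grad u i x| * |H1.grad φ i x| := by
        rw [integral_const_mul, integral_finsetSum _ fun i _ => hi i]
    _ ≤ M * ∑ _i : Fin n, ‖u‖ * ‖φ‖ := by
        gcongr with i
        exact (integral_abs_mul_abs_le _ _).trans (mul_le_mul (H1.norm_grad_le u i)
          (H1.norm_grad_le φ i) (norm_nonneg _) (norm_nonneg _))
    _ = M * n * ‖u‖ * ‖φ‖ := by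
        simp
        ring

theorem le_gradForm_self {c : E n → ℝ} {m M : ℝ}
    (hc : AEStronglyMeasurable c (volume.restrict Ω))
    (hM : ∀ᵐ x ∂volume.restrict Ω, |c x| ≤ M) (hm : ∀ᵐ x ∂volume.restrict Ω, m ≤ c x)
    (u : H1 Ω) : m * ∑ i, ‖H1.grad u i‖ ^ 2 ≤ gradForm c u u := by
  have hi (i : Fin n) := integrable_grad_mul_grad u u i
  simp only [norm_sq_eq_integral]
  rw [← integral_finsetSum _ fun i _ => hi i, ← integral_const_mul]
  refine integral_mono_ae ((integrable_finsetSum _ fun i _ => hi i).const_mul m)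
    (integrable_gradForm hc hM u u) ?_
  filter_upwards [hm] with x hx
  exact mul_le_mul_of_nonneg_right hx (Finset.sum_nonneg fun i _ => mul_self_nonneg _)

end EllipticForm

/-! ### Lax–Milgram and the bounds on the coefficient -/

/-- The Lax–Milgram theorem with the a priori bound, for a symmetric form. -/
theorem existsUnique_and_norm_le_of_coercive {V : Type*} [NormedAddCommGroup V]
    [InnerProductSpace ℝ V] [CompleteSpace V] (B : V → V → ℝ) (hcomm : ∀ u φ, B u φ = B φ u)
    (hadd : ∀ u v φ, B (u + v) φ = B u φ + B v φ) (hsmul : ∀ (k : ℝ) u φ, B (k • u) φ = k * B u φ)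
    {M : ℝ} (hM : ∀ u φ, |B u φ| ≤ M * ‖u‖ * ‖φ‖) {P : ℝ} (hP0 : 0 < P)
    (hP : ∀ u, ‖u‖ ^ 2 ≤ P * B u u) (v : StrongDual ℝ V) :
    (∃! u, ∀ φ, -B u φ = v φ) ∧ ∀ u, (∀ φ, -B u φ = v φ) → ‖u‖ ≤ P * ‖v‖ := by
  let L : V →L[ℝ] V →L[ℝ] ℝ := LinearMap.mkContinuous₂
    (LinearMap.mk₂ ℝ B hadd hsmul
      (fun u v φ => by rw [hcomm, hadd, hcomm v, hcomm φ])
      (fun k u φ => by rw [hcomm, hsmul, hcomm φ, smul_eq_mul])) M hM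
  have hcoer : IsCoercive L := by
    refine ⟨P⁻¹, by positivity, fun u => ?_⟩
    calc P⁻¹ * ‖u‖ * ‖u‖ = P⁻¹ * ‖u‖ ^ 2 := by ring
      _ ≤ P⁻¹ * (P * B u u) := by gcongr; exact hP u
      _ = L u u := inv_mul_cancel_left₀ hP0.ne' _
  let T := hcoer.continuousLinearEquivOfBilin
  have hT (u φ : V) : inner ℝ (T u) φ = B u φ := hcoer.continuousLinearEquivOfBilin_apply u φ
  -- The Riesz representative is that of `-v` because the equation reads `-B u φ = v φ`.
  let y := (InnerProductSpace.toDual ℝ V).symm (-v)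
  have hy (φ : V) : inner ℝ y φ = -v φ := InnerProductSpace.toDual_symm_apply
  refine ⟨⟨T.symm y, fun φ => ?_, fun u hu => ?_⟩, fun u hu => ?_⟩
  · rw [← hT, T.apply_symm_apply, hy, neg_neg]
  · rw [T.eq_symm_apply]
    exact ext_inner_right ℝ fun φ => by rw [hT, hy, ← hu, neg_neg]
  · have h1 : B u u ≤ ‖v‖ * ‖u‖ := by
      rw [← neg_neg (B u u), hu u]
      exact (neg_le_abs _).trans (v.le_opNorm u)
    have h2 : ‖u‖ * ‖u‖ ≤ P * ‖v‖ * ‖u‖ := by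
      calc ‖u‖ * ‖u‖ = ‖u‖ ^ 2 := by ring
        _ ≤ P * B u u := hP u
        _ ≤ P * (‖v‖ * ‖u‖) := by gcongr
        _ = P * ‖v‖ * ‖u‖ := by ring
    rcases (norm_nonneg u).eq_or_lt with h | h
    · rw [← h]; positivity
    · exact le_of_mul_le_mul_right h2 h

instance H1.innerProductSpace (Ω : Set (E n)) : InnerProductSpace ℝ (H1 Ω) := inferInstance

/-- The inner product of `H¹₀(Ω)`, over the additive group that Lax–Milgram sees. -/
instance H10.innerProductSpace (Ω : Set (E n)) :
    @InnerProductSpace ℝ (H10 Ω) _ (H10 Ω).normedAddCommGroup.toSeminormedAddCommGroup :=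
  Submodule.innerProductSpace (H10 Ω)

/-- The embedding applied to `w - w₀` gives `|w - w₀| ≤ κ/2` a.e., so `w` stays above `κ/2`, and
cubing is monotone there. -/
theorem ae_cube_bounds {Ω : Set (E n)} {C κ r : ℝ} (hC : 0 < C) (hκ : 0 < κ)
    (hsup : ∀ u : H2 Ω, ∀ᵐ x ∂volume.restrict Ω, |H2.fn u x| ≤ C * ‖u‖) {w₀ : H2 Ω}
    (hess : essInf (H2.fn w₀) (volume.restrict Ω) = κ) (hr : r < κ / (2 * C)) {w : H2 Ω}
    (hw : ‖w - w₀‖ ≤ r) :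
    (∀ᵐ x ∂volume.restrict Ω, |H2.fn w x ^ 3| ≤ (C * ‖w‖) ^ 3) ∧
      ∀ᵐ x ∂volume.restrict Ω, (κ / 2) ^ 3 ≤ H2.fn w x ^ 3 := by
  constructor
  · filter_upwards [hsup w] with x hx
    rw [abs_pow]
    exact pow_le_pow_left₀ (abs_nonneg _) hx 3
  · have hbdd : IsBoundedUnder (· ≥ ·) (ae (volume.restrict Ω)) (H2.fn w₀) :=
      ⟨-(C * ‖w₀‖), eventually_map.2 ((hsup w₀).mono fun x hx => (abs_le.1 hx).1)⟩
    have hCr : C * ‖w - w₀‖ ≤ κ / 2 := by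
      calc C * ‖w - w₀‖ ≤ C * (κ / (2 * C)) := by gcongr; exact hw.trans hr.le
        _ = κ / 2 := by field_simp
    filter_upwards [ae_essInf_le hbdd, hsup (w - w₀), Lp.coeFn_sub (H2.fn w) (H2.fn w₀)]
      with x h1 h2 h3
    have h4 : H2.fn (w - w₀) x = H2.fn w x - H2.fn w₀ x := h3
    rw [h4] at h2
    rw [hess] at h1
    exact pow_le_pow_left₀ (by positivity) (by linarith [(abs_le.1 h2).1]) 3

/-- A bounded coefficient makes the integrability clause automatic. -/
theorem isWeakSolution_iff {Ω : Set (E n)} {w : H2 Ω} {M : ℝ}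
    (hM : ∀ᵐ x ∂volume.restrict Ω, |H2.fn w x ^ 3| ≤ M) (v : Hneg1 Ω) (u : H10 Ω) :
    IsWeakSolution w v u ↔
      ∀ φ : H10 Ω, -gradForm (fun x => H2.fn w x ^ 3) u.1 φ.1 = v φ :=
  forall_congr' fun φ =>
    and_iff_right (integrable_gradForm ((Lp.aestronglyMeasurable (H2.fn w)).pow 3) hM u.1 φ.1)

theorem H10.existsUnique_and_norm_le_of_coercive {Ω : Set (E n)} (B : H10 Ω → H10 Ω → ℝ)
    (hcomm : ∀ u φ, B u φ = B φ u)
    (hadd : ∀ u v φ, B (u + v) φ = B u φ + B v φ) (hsmul : ∀ (k : ℝ) u φ, B (k • u) φ = k * B u φ)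
    {M : ℝ} (hM : ∀ u φ, |B u φ| ≤ M * ‖u‖ * ‖φ‖) {P : ℝ} (hP0 : 0 < P)
    (hP : ∀ u, ‖u‖ ^ 2 ≤ P * B u u) (v : Hneg1 Ω) :
    (∃! u, ∀ φ, -B u φ = v φ) ∧ ∀ u, (∀ φ, -B u φ = v φ) → ‖u‖ ≤ P * ‖v‖ :=
  @Elliptic.existsUnique_and_norm_le_of_coercive (H10 Ω) (H10 Ω).normedAddCommGroup
    (H10.innerProductSpace Ω) inferInstance B hcomm hadd hsmul M hM P hP0 hP v

end Elliptic

end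

theorem mainTheorem7 (n : ℕ) (hn : n = 1 ∨ n = 2) (Ω : Set (Elliptic.E n))
    (hopen : IsOpen Ω) (hbdd : Bornology.IsBounded Ω) (hsmooth : Elliptic.HasSmoothBoundary Ω) :
    ∃ C : ℝ, 0 < C ∧ ∀ κ : ℝ, 0 < κ → ∃ C₀ : ℝ, 0 < C₀ ∧
      ∀ w₀ : Elliptic.H2 Ω, essInf (Elliptic.H2.fn w₀) (volume.restrict Ω) = κ →
      ∀ r : ℝ, 0 < r → r < κ / (2 * C) →
      ∀ w : Elliptic.H2 Ω, ‖w - w₀‖ ≤ r →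
      ∀ v : Elliptic.Hneg1 Ω,
        (∃! u : Elliptic.H10 Ω, Elliptic.IsWeakSolution w v u) ∧
        ∀ u : Elliptic.H10 Ω, Elliptic.IsWeakSolution w v u → ‖u‖ ≤ C₀ * ‖v‖ := by
  obtain ⟨C, hC, hsup⟩ := Elliptic.exists_sup_bound hn hopen hbdd hsmooth
  obtain ⟨P, hP0, hP⟩ := Elliptic.exists_poincare (by omega) hopen hbdd
  -- The Poincaré constant divided by the lower bound of `w³`: it depends on `κ` and `Ω` only.
  refine ⟨C, hC, fun κ hκ => ⟨P / (κ / 2) ^ 3, by positivity, ?_⟩⟩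
  intro w₀ hess r _ hr w hw v
  obtain ⟨hM, hm⟩ := Elliptic.ae_cube_bounds hC hκ hsup hess hr hw
  have hc : AEStronglyMeasurable (fun x => Elliptic.H2.fn w x ^ 3) (volume.restrict Ω) :=
    (Lp.aestronglyMeasurable (Elliptic.H2.fn w)).pow 3
  simp only [Elliptic.isWeakSolution_iff hM]
  refine Elliptic.H10.existsUnique_and_norm_le_of_coercive
    (fun u φ : Elliptic.H10 Ω =>
      Elliptic.gradForm (fun x => Elliptic.H2.fn w x ^ 3) u.1 φ.1)
    (fun u φ => Elliptic.gradForm_comm _ _ _) (fun u v φ => Elliptic.gradForm_add_left hc hM _ _ _)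
    (fun k u φ => Elliptic.gradForm_smul_left _ _ _ _)
    (fun u φ => Elliptic.abs_gradForm_le (by positivity) hc hM _ _) (by positivity)
    (fun u => (hP u).trans ?_) v
  calc P * ∑ i, ‖Elliptic.H1.grad u.1 i‖ ^ 2
      = P / (κ / 2) ^ 3 * ((κ / 2) ^ 3 * ∑ i, ‖Elliptic.H1.grad u.1 i‖ ^ 2) := by field_simp
    _ ≤ P / (κ / 2) ^ 3 * Elliptic.gradForm (fun x => Elliptic.H2.fn w x ^ 3) u.1 u.1 :=
      mul_le_mul_of_nonneg_left (Elliptic.le_gradForm_self hc hM hm u.1) (by positivity)
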